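/- **Notation and definitions.** Regular cardinals are infinite. $\sigma^{+n}$ is the $n$-th cardinal successor of $\sigma$. For a cardinal $\tau$, $[X]^{\tau}$ (resp. $[X]^{<\tau}$) is the set of subsets of $X$ of cardinality exactly (resp. less than) $\tau$. For a regular cardinal $\Theta$, $H(\Theta)$ is the set of all sets whose transitive closure has cardinality less than $\Theta$. A family $\langle A_\alpha\rangle_{\alpha<\kappa}$ of (not necessarily distinct) sets is *point-$<\tau$* if $\bigcap_{\alpha\in I}A_\alpha=\emptyset$ for every $I\in[\kappa]^{\tau}$; *point-finite* means point-$<\aleph_0$. A set $M$ is *weakly closed* if for every regular cardinal $\tau$ and every $I\in[M]^{\tau}$ there is $J\in[I]^{\tau}$ with $[J]^{<\tau}\subseteq M$. A sequence $\langle M_\xi\rangle_{\xi<\alpha}$ is an *$\in$-chain* if $M_\xi\subseteq M_\eta$ for all $\xi<\eta<\alpha$ and $\langle M_\xi:\xi\le\eta\rangle\in M_{\eta+1}$ whenever $\eta+1<\alpha$; it is *continuous* if $M_\delta=\bigcup_{\xi<\delta}M_\xi$ for all limit ordinals $0<\delta<\alpha$. The *Closed Continuous $\in$-chain Axiom* (CECA)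 is the statement: for every uncountable cardinal $\lambda$, every regular cardinal $\Theta>\lambda$ and all sets $A,B\in H(\Theta)$ with $|A|=\lambda$ and $|B|<\lambda$, there is a continuous $\in$-chain $\langle M_\xi\rangle_{\xi<\mathrm{cf}(\lambda)}$ of weakly closed elementary submodels of $H(\Theta)$ such that $|M_\xi|<\lambda$ for every $\xi<\mathrm{cf}(\lambda)$, $B\in M_0$, and $A\subseteq\bigcup_{\xi<\mathrm{cf}(\lambda)}M_\xi$. **Theorem 3.1.** Let $n\ge1$, let $\sigma$ be a regular cardinal, and let $\langle A_\alpha\rangle_{\alpha<\kappa}$ be a sequence of (not necessarily distinct) sets with $|A_\alpha|\le\sigma^{+n}$ for all $\alpha<\kappa$. (a) Assume CECA and that one of the following conditions holds: * $|A_\alpha\cap A_\beta|<\sigma$ for all $\alpha<\beta<\kappa$; * $|A_\alpha\cap A_\beta|\le\sigma$ for all $\alpha<\beta<\kappa$, and $|\{\alpha<\kappa: S\subseteq A_\alpha\}|\le\sigma$ for every $S\in[\bigcup_{\alpha<\kappa}A_\alpha]^{\sigma}$. Then there are sets $A'_\alpha$ ($\alpha<\kappa$) with $|A'_\alpha|\le\sigma$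 such that $\langle A_\alpha\setminus A'_\alpha\rangle_{\alpha<\kappa}$ is point-$<n+1$. (b) (In ZFC, without CECA.) If $\langle A_\alpha\rangle_{\alpha<\kappa}$ is point-finite and $|A_\alpha\cap A_\beta|\le\sigma$ for all $\alpha<\beta<\kappa$, then there are $A'_\alpha\subseteq A_\alpha$ with $|A'_\alpha|\le\sigma$ such that $\langle A_\alpha\setminus A'_\alpha\rangle_{\alpha<\kappa}$ is point-$<n+1$. -/

import Mathlib

open Cardinal Order

universe u

namespace Ceca

/-- The relation symbols of the language of set theory: one binary symbol. -/
inductive MemRel : ℕ → Type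
  | mem : MemRel 2

/-- The first-order language of set theory (equality is a logical symbol). -/
def setLang : FirstOrder.Language.{0, 0} := ⟨fun _ => Empty, MemRel⟩

/-- `H Θ` is the collection of all sets whose transitive closure has cardinality less than `Θ`
(equivalently, which are contained in some transitive set of cardinality less than `Θ`). -/
def H (Θ : Cardinal.{u}) : Set ZFSet.{u} :=
  {x | ∃ t : ZFSet.{u}, t.IsTransitive ∧ x ⊆ t ∧ t.card < Θ}

/-- `H Θ` as a structure for the language of set theory, with the true membership relation. -/
instance instStructureH (Θ : Cardinal.{u}) : setLang.Structure (H Θ) where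
  funMap := fun f _ => f.elim
  RelMap := fun
    | .mem, v => (v 0 : ZFSet.{u}) ∈ (v 1 : ZFSet.{u})

/-- `M ≺ H(Θ)`: the set `M` is the underlying set of an elementary submodel of `H(Θ)`. -/
def IsElementarySubmodel (Θ : Cardinal.{u}) (M : ZFSet.{u}) : Prop :=
  ∃ S : setLang.ElementarySubstructure (H Θ), ∀ x : ZFSet.{u}, x ∈ M ↔ ∃ y ∈ S, (y : ZFSet.{u}) = x

/-- `M` is weakly `τ`-closed: every `I ∈ [M]^τ` has a subset `J ∈ [I]^τ`
such that `[J]^{<τ} ⊆ M`. -/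
def IsWeaklyClosedAt (τ : Cardinal.{u}) (M : ZFSet.{u}) : Prop :=
  ∀ I : ZFSet.{u}, I ⊆ M → I.card = τ →
    ∃ J : ZFSet.{u}, J ⊆ I ∧ J.card = τ ∧ ∀ K : ZFSet.{u}, K ⊆ J → K.card < τ → K ∈ M

/-- `M` is weakly closed: it is weakly `τ`-closed for all regular (infinite) cardinals `τ`. -/
def IsWeaklyClosed (M : ZFSet.{u}) : Prop :=
  ∀ τ : Cardinal.{u}, τ.IsRegular → IsWeaklyClosedAt τ M

/-- The sequence `⟨M ξ : ξ ≤ η⟩` as a set: the set of all ordered pairs `(ξ, M ξ)` with `ξ ≤ η`,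
where the ordinal `ξ` is read as a von Neumann ordinal. -/
noncomputable def initialSegment (M : Ordinal.{u} → ZFSet.{u}) (η : Ordinal.{u}) : ZFSet.{u} :=
  ZFSet.range fun ξ : Set.Iic η => ZFSet.pair (ξ : Ordinal.{u}).toZFSet (M ξ)

/-- `⟨M ξ : ξ < α⟩` is an `∈`-chain (the values of `M` at ordinals `≥ α` play no role). -/
def IsMemChain (α : Ordinal.{u}) (M : Ordinal.{u} → ZFSet.{u}) : Prop :=
  (∀ ξ η : Ordinal.{u}, ξ < η → η < α → M ξ ⊆ M η) ∧
    ∀ η : Ordinal.{u}, η + 1 < α → initialSegment M η ∈ M (η + 1)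

/-- `⟨M ξ : ξ < α⟩` is continuous: unions are taken at (nonzero) limit ordinals. -/
def IsContinuousChain (α : Ordinal.{u}) (M : Ordinal.{u} → ZFSet.{u}) : Prop :=
  ∀ δ : Ordinal.{u}, δ < α → IsSuccLimit δ → ∀ x : ZFSet.{u}, x ∈ M δ ↔ ∃ ξ < δ, x ∈ M ξ

/-- The Closed Continuous `∈`-chain Axiom for the cardinal `lam`. -/
def CECAAt (lam : Cardinal.{u}) : Prop :=
  ∀ Θ : Cardinal.{u}, Θ.IsRegular → lam < Θ →
    ∀ A B : ZFSet.{u}, A ∈ H Θ → B ∈ H Θ → A.card = lam → B.card < lam →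
      ∃ M : Ordinal.{u} → ZFSet.{u},
        IsMemChain lam.ord.cof.ord M ∧
        IsContinuousChain lam.ord.cof.ord M ∧
        (∀ ξ < lam.ord.cof.ord,
          IsWeaklyClosed (M ξ) ∧ IsElementarySubmodel Θ (M ξ) ∧ (M ξ).card < lam) ∧
        B ∈ M 0 ∧
        ∀ a ∈ A, ∃ ξ < lam.ord.cof.ord, a ∈ M ξ

/-- The Closed Continuous `∈`-chain Axiom. -/
def CECA : Prop :=
  ∀ lam : Cardinal.{u}, ℵ₀ < lam → CECAAt lam

/-- The indexed family `A` (with repetitions allowed) is point-`<τ`: for every set `I` of exactly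
`τ` indices, the intersection of the sets `A i`, `i ∈ I`, is empty. -/
def IsPointLT {ι X : Type u} (A : ι → Set X) (τ : Cardinal.{u}) : Prop :=
  ∀ I : Set ι, #I = τ → ⋂ i ∈ I, A i = ∅

end Ceca

/-!
The sets `A'` come from *rankings*. Suppose that the indices and the points are exhausted by a chain
of small sets, and let the rank of an object be the first stage that contains it. If the stages are
closed enough, every `A α` has at most `σ` points older than `α`; these are deleted. Intersections
`A α ∩ A β` have size at most `σ`, so a stage containing `α` and `β` contains all of `A α ∩ A β`;
hence a point lies in at most one member that is strictly older than the point. All other members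
through that point have the same rank as the point, and these form a smaller subfamily
(`IsEssentiallyPointLE.succ_of_levels`). Starting from `σ⁺` indices, where the members can be made
disjoint, this bounds the multiplicity by `m` for `σ^{+m}` indices. When there are more than
`σ^{+n}` indices, the stages can be chosen closed under `α ↦ A α` as well. Then no point is younger
than a member through it, and induction on the number of indices keeps the bound `n`
(`isEssentiallyPointLE_of_hasRanking`).

In the point-finite case rankings exist outright: close initial segments of an enumeration of the
indices under the intersections and under the finite sets `{α | x ∈ A α}`; then `A α` misses every
stage that omits `α` (`hasRanking_of_pointFinite`).

Under CECA the stages are traces of elementary submodels `M` of some `H(Θ)`. A parameter in the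
first model, the graph of one function `g`, enumerates each set `T s` of size at most `μ` by any
set `C` of size `μ`. From some stage on, there is such a `C` with `C ∈ M` and `C ⊆ M`
(`Ceca.exists_code_mem_of_chain`), so `T s ⊆ M` as soon as `s ∈ M`. This gives the closure
properties, and with weak closedness at `σ⁺` it gives `|A α ∩ M| ≤ σ` for `α ∉ M`
(`hasRanking_of_ceca`).
-/

/-! ### Rankings and multiplicities -/

/-- The subfamily of `A` indexed by `K` becomes point-`≤ m` after deleting at most `σ` points from
each of its members: every `x` lies in at most `m` of the sets `A α \ A' α`, `α ∈ K`. -/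
def IsEssentiallyPointLE {ι X : Type u} (A : ι → Set X) (σ : Cardinal.{u}) (K : Set ι) (m : ℕ) :
    Prop :=
  ∃ A' : ι → Set X, (∀ α ∈ K, #(A' α) ≤ σ) ∧ ∀ x, {α ∈ K | x ∈ A α \ A' α}.encard ≤ m

/-- Ordinal ranks of the indices in `K` and of the points of the family `A`, as produced by a chain
of small closed sets: the rank of an object is the stage at which it first appears. Each stage
contributes fewer than `#K` indices, each member of the family has at most `σ` points that are older
than its index, a point common to two members is no younger than both indices, and a member of
size at most `μ` has no points younger than its index. -/
def HasRanking {ι X : Type u} (A : ι → Set X) (σ μ : Cardinal.{u}) (K : Set ι) : Prop :=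
  ∃ (r : ι → Ordinal.{u}) (s : X → Ordinal.{u}),
    (∀ w, #{α ∈ K | r α = w} < #K) ∧
    (∀ α ∈ K, #{x ∈ A α | s x < r α} ≤ σ) ∧
    (∀ α ∈ K, ∀ β ∈ K, α ≠ β → ∀ x ∈ A α ∩ A β, s x ≤ max (r α) (r β)) ∧
    ∀ α ∈ K, #(A α) ≤ μ → ∀ x ∈ A α, s x ≤ r α

section Rankings

variable {ι X : Type u} {A : ι → Set X} {σ μ : Cardinal.{u}} {K : Set ι}

/-- The ranks of the points `x` of a remainder `A α \ A' α` satisfy `r α ≤ s x`. The indices with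
`r α = s x` are handled level by level, and at most one index has `r α < s x`. -/
theorem exists_delete_of_levels (hσ : ℵ₀ ≤ σ) {r : ι → Ordinal.{u}} {s : X → Ordinal.{u}} {m : ℕ}
    (hold : ∀ α ∈ K, #{x ∈ A α | s x < r α} ≤ σ)
    (hlevel : ∀ w, IsEssentiallyPointLE A σ {α ∈ K | r α = w} m) :
    ∃ A' : ι → Set X, (∀ α ∈ K, #(A' α) ≤ σ) ∧
      (∀ x, ∀ α ∈ K, x ∈ A α \ A' α → r α ≤ s x) ∧
      ∀ x, {α ∈ K | x ∈ A α \ A' α ∧ r α = s x}.encard ≤ m := by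
  choose B hB hBx using hlevel
  refine ⟨fun α => {x ∈ A α | s x < r α} ∪ B (r α) α, fun α hα => ?_, fun x α hα hx => ?_,
    fun x => ?_⟩
  · exact (mk_union_le _ _).trans
      (add_le_of_le hσ (hold α hα) (hB (r α) α ⟨hα, rfl⟩))
  · by_contra hlt
    exact hx.2 (Or.inl ⟨hx.1, not_le.1 hlt⟩)
  · refine (Set.encard_le_encard ?_).trans (hBx (s x) x)
    rintro α ⟨hα, hx, hr⟩
    refine ⟨⟨hα, hr⟩, hx.1, fun h => hx.2 (Or.inr ?_)⟩
    rw [hr]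
    exact h

theorem IsEssentiallyPointLE.succ_of_levels (hσ : ℵ₀ ≤ σ) {r : ι → Ordinal.{u}}
    {s : X → Ordinal.{u}} {m : ℕ}
    (hold : ∀ α ∈ K, #{x ∈ A α | s x < r α} ≤ σ)
    (hinter : ∀ α ∈ K, ∀ β ∈ K, α ≠ β → ∀ x ∈ A α ∩ A β, s x ≤ max (r α) (r β))
    (hlevel : ∀ w, IsEssentiallyPointLE A σ {α ∈ K | r α = w} m) :
    IsEssentiallyPointLE A σ K (m + 1) := by
  obtain ⟨A', hA', hle, hlev⟩ := exists_delete_of_levels hσ hold hlevel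
  refine ⟨A', hA', fun x => ?_⟩
  have hone : {α ∈ K | x ∈ A α \ A' α ∧ r α < s x}.encard ≤ 1 := by
    rw [Set.encard_le_one_iff]
    rintro α β ⟨hα, hxα, hrα⟩ ⟨hβ, hxβ, hrβ⟩
    by_contra hne
    exact (hinter α hα β hβ hne x ⟨hxα.1, hxβ.1⟩).not_gt (max_lt hrα hrβ)
  calc {α ∈ K | x ∈ A α \ A' α}.encard
      ≤ ({α ∈ K | x ∈ A α \ A' α ∧ r α = s x} ∪
          {α ∈ K | x ∈ A α \ A' α ∧ r α < s x}).encard := by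
        refine Set.encard_le_encard ?_
        rintro α ⟨hα, hx⟩
        rcases (hle x α hα hx).eq_or_lt with h | h
        · exact Or.inl ⟨hα, hx, h⟩
        · exact Or.inr ⟨hα, hx, h⟩
    _ ≤ m + 1 := (Set.encard_union_le _ _).trans (add_le_add (hlev x) hone)
    _ = ((m + 1 : ℕ) : ℕ∞) := by push_cast; rfl

theorem IsEssentiallyPointLE.of_levels (hσ : ℵ₀ ≤ σ) {r : ι → Ordinal.{u}}
    {s : X → Ordinal.{u}} {m : ℕ}
    (hold : ∀ α ∈ K, #{x ∈ A α | s x < r α} ≤ σ)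
    (hnew : ∀ α ∈ K, ∀ x ∈ A α, s x ≤ r α)
    (hlevel : ∀ w, IsEssentiallyPointLE A σ {α ∈ K | r α = w} m) :
    IsEssentiallyPointLE A σ K m := by
  obtain ⟨A', hA', hle, hlev⟩ := exists_delete_of_levels hσ hold hlevel
  refine ⟨A', hA', fun x => (Set.encard_le_encard ?_).trans (hlev x)⟩
  rintro α ⟨hα, hx⟩
  exact ⟨hα, hx, (hle x α hα hx).antisymm (hnew α hα x hx.1)⟩

/-- Every set `W` has an enumeration, given by an injective rank, in order type at most the initial
ordinal of its cardinality. -/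
theorem exists_rank_lt_ord {V : Type u} (W : Set V) :
    ∃ f : V → Ordinal.{u}, Set.InjOn f W ∧ ∀ v ∈ W, f v < (#W).ord := by
  classical
  obtain ⟨r, wo, hr⟩ := Cardinal.exists_ord_eq W
  refine ⟨fun v => if h : v ∈ W then Ordinal.typein r ⟨v, h⟩ else 0, ?_, ?_⟩
  · intro v hv w hw h
    simp only [hv, hw, dif_pos] at h
    exact congrArg Subtype.val (Ordinal.typein_injective r h)
  · intro v hv
    simp only [hv, dif_pos]
    rw [hr]
    exact Ordinal.typein_lt_type r _

theorem mk_le_card_of_injOn {V : Type u} {S : Set V} {f : V → Ordinal.{u}} (hf : Set.InjOn f S)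
    {o : Ordinal.{u}} (ho : ∀ v ∈ S, f v < o) : #S ≤ o.card := by
  have h : lift.{u + 1} #S ≤ lift.{u + 1} #(Set.Iio o) :=
    Cardinal.mk_le_of_injective (f := fun v : ULift.{u + 1} S =>
        (ULift.up ⟨f v.down, ho v.down v.down.2⟩ : ULift.{u + 1} (Set.Iio o)))
      fun v w hvw => ULift.ext _ _ <| Subtype.ext <|
        hf v.down.2 w.down.2 (congrArg Subtype.val (congrArg ULift.down hvw))
  rw [Cardinal.mk_Iio_ordinal] at h
  simpa [← Ordinal.lift_card] using h

/-- A family of at most `σ⁺` sets with pairwise intersections of size at most `σ` is made pairwise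
disjoint by deleting from each set its intersections with the at most `σ` earlier ones. -/
theorem isEssentiallyPointLE_one (hσ : ℵ₀ ≤ σ)
    (hA : ∀ α β, α ≠ β → #(A α ∩ A β : Set X) ≤ σ) (hK : #K ≤ succ σ) :
    IsEssentiallyPointLE A σ K 1 := by
  obtain ⟨f, hf, hlt⟩ := exists_rank_lt_ord K
  refine ⟨fun α => ⋃ β ∈ {β ∈ K | f β < f α}, A α ∩ A β, fun α hα => ?_, fun x => ?_⟩
  · have hcard : #{β ∈ K | f β < f α} ≤ σ := by
      refine (mk_le_card_of_injOn (hf.mono fun β hβ => hβ.1) (o := f α) fun β hβ => hβ.2).trans ?_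
      exact Order.lt_succ_iff.1 ((lt_ord.1 (hlt α hα)).trans_le hK)
    refine (mk_biUnion_le _ _).trans (mul_le_of_le hσ hcard ?_)
    refine ciSup_le' fun β => hA _ _ ?_
    rintro h
    exact β.2.2.ne (congrArg f h).symm
  · rw [Nat.cast_one, Set.encard_le_one_iff]
    have key : ∀ α ∈ K, ∀ β ∈ K, x ∈ A α → x ∈ A β → f α < f β →
        x ∈ ⋃ γ ∈ {γ ∈ K | f γ < f β}, A β ∩ A γ := by
      intro α hα β hβ hxα hxβ h
      exact Set.mem_biUnion (show α ∈ {γ ∈ K | f γ < f β} from ⟨hα, h⟩) ⟨hxβ, hxα⟩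
    rintro α β ⟨hα, hxα⟩ ⟨hβ, hxβ⟩
    rcases lt_trichotomy (f α) (f β) with h | h | h
    · exact (hxβ.2 (key α hα β hβ hxα.1 hxβ.1 h)).elim
    · exact hf hα hβ h
    · exact (hxα.2 (key β hβ α hα hxβ.1 hxα.1 h)).elim

theorem le_iterate_succ (σ : Cardinal.{u}) (m : ℕ) : σ ≤ succ^[m] σ := by
  induction m with
  | zero => exact le_rfl
  | succ m ih =>
    rw [Function.iterate_succ_apply']
    exact ih.trans (le_succ _)

/-- For at most `σ^{+m}` indices the members may be arbitrarily large: each successor step costs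
one more multiplicity. -/
theorem isEssentiallyPointLE_of_mk_le (hσ : ℵ₀ ≤ σ)
    (hA : ∀ α β, α ≠ β → #(A α ∩ A β : Set X) ≤ σ)
    (hrank : ∀ K : Set ι, σ < #K → HasRanking A σ σ K) (m : ℕ) :
    ∀ K : Set ι, #K ≤ succ^[m + 1] σ → IsEssentiallyPointLE A σ K (m + 1) := by
  induction m with
  | zero => exact fun K hK => isEssentiallyPointLE_one hσ hA hK
  | succ m ih =>
    intro K hK
    rcases le_or_gt #K σ with h | h
    · obtain ⟨A', h1, h2⟩ := ih K (h.trans (le_iterate_succ _ _))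
      exact ⟨A', h1, fun x => (h2 x).trans (by exact_mod_cast Nat.le_succ _)⟩
    · obtain ⟨r, s, hlev, hold, hinter, -⟩ := hrank K h
      refine IsEssentiallyPointLE.succ_of_levels hσ hold hinter fun w => ih _ ?_
      rw [Function.iterate_succ_apply'] at hK
      exact Order.lt_succ_iff.1 ((hlev w).trans_le hK)

/-- Once the members have size at most `σ^{+n}`, there is no further cost in passing to more than
`σ^{+n}` indices, since the levels of a ranking are then disjoint families. -/
theorem isEssentiallyPointLE_of_hasRanking (hσ : ℵ₀ ≤ σ)
    (hA : ∀ α β, α ≠ β → #(A α ∩ A β : Set X) ≤ σ)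
    (hrank : ∀ μ, σ ≤ μ → ∀ K : Set ι, μ < #K → HasRanking A σ μ K) {n : ℕ} (hn : 1 ≤ n)
    (hsize : ∀ α, #(A α) ≤ succ^[n] σ) (K : Set ι) : IsEssentiallyPointLE A σ K n := by
  obtain ⟨m, rfl⟩ := Nat.exists_eq_add_of_le' hn
  induction hκ : #K using WellFoundedLT.induction generalizing K with
  | ind κ ih =>
    subst hκ
    rcases le_or_gt #K (succ^[m + 1] σ) with h | h
    · exact isEssentiallyPointLE_of_mk_le hσ hA (hrank σ le_rfl) m K h
    · obtain ⟨r, s, hlev, hold, -, hnew⟩ := hrank _ (le_iterate_succ σ _) K h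
      exact IsEssentiallyPointLE.of_levels hσ hold (fun α hα => hnew α hα (hsize α))
        fun w => ih _ (hlev w) _ rfl

/-- A chain of sets of indices and points, closed enough, yields a ranking: the rank of an object is
the first stage of the chain that contains it. -/
theorem HasRanking.of_chain {o : Ordinal.{u}} {N : Ordinal.{u} → Set (ι ⊕ X)} (hK : K.Nonempty)
    (hmono : ∀ ξ η, ξ ≤ η → η < o → N ξ ⊆ N η)
    (hcard : ∀ ξ < o, #(N ξ) < #K)
    (hcover : ∀ α ∈ K, ∃ ξ < o, Sum.inl α ∈ N ξ)
    (hinter : ∀ ξ < o, ∀ α β, α ≠ β → Sum.inl α ∈ N ξ → Sum.inl β ∈ N ξ →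
      ∀ x ∈ A α ∩ A β, Sum.inr x ∈ N ξ)
    (hsub : ∀ ξ < o, ∀ α, #(A α) ≤ μ → Sum.inl α ∈ N ξ → ∀ x ∈ A α, Sum.inr x ∈ N ξ)
    (hold : ∀ ξ < o, ∀ α, Sum.inl α ∈ N ξ → (∀ η < ξ, Sum.inl α ∉ N η) →
      #{x ∈ A α | ∃ η < ξ, Sum.inr x ∈ N η} ≤ σ) :
    HasRanking A σ μ K := by
  classical
  -- Objects that never appear get the rank `o`; this concerns points only.
  have hex : ∀ v : ι ⊕ X, ∃ ρ, (∀ ξ < o, v ∈ N ξ → ρ ≤ ξ) ∧ (ρ < o → v ∈ N ρ) := by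
    intro v
    by_cases h : ∃ ξ, ξ < o ∧ v ∈ N ξ
    · have hmem := csInf_mem (s := {ξ | ξ < o ∧ v ∈ N ξ}) h
      exact ⟨sInf {ξ | ξ < o ∧ v ∈ N ξ}, fun ξ hξ hv => csInf_le' ⟨hξ, hv⟩, fun _ => hmem.2⟩
    · exact ⟨o, fun ξ hξ hv => (h ⟨ξ, hξ, hv⟩).elim, fun h' => (lt_irrefl _ h').elim⟩
  choose ρ hρle hρmem using hex
  have hlt : ∀ α ∈ K, ρ (.inl α) < o := fun α hα => by
    obtain ⟨ξ, hξ, hm⟩ := hcover α hα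
    exact (hρle _ ξ hξ hm).trans_lt hξ
  refine ⟨fun α => ρ (.inl α), fun x => ρ (.inr x), fun w => ?_, fun α hα => ?_,
    fun α hα β hβ hne x hx => ?_, fun α hα hμ x hx => ?_⟩
  · by_cases hw : w < o
    · refine lt_of_le_of_lt ?_ (hcard w hw)
      refine mk_le_of_injective (f := fun α => ⟨Sum.inl α.1, ?_⟩) ?_
      · obtain ⟨α, hα, rfl⟩ := α
        exact hρmem _ (hlt _ hα)
      · intro α β h
        exact Subtype.ext (Sum.inl_injective (congrArg Subtype.val h))
    · have : {α ∈ K | ρ (.inl α) = w} = ∅ := by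
        ext α
        simp only [Set.mem_ofPred_eq, Set.mem_empty_iff_false, iff_false, not_and]
        rintro hα rfl
        exact hw (hlt α hα)
      rw [this, mk_eq_zero]
      exact pos_iff_ne_zero.2 (mk_ne_zero_iff.2 hK.to_subtype)
  · refine le_trans (mk_le_mk_of_subset ?_)
      (hold (ρ (.inl α)) (hlt α hα) α (hρmem _ (hlt α hα)) fun η hη hm => ?_)
    · rintro x ⟨hx, hlt'⟩
      exact ⟨hx, _, hlt', hρmem _ (hlt'.trans (hlt α hα))⟩
    · exact (hρle _ η (hη.trans (hlt α hα)) hm).not_gt hη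
  · have hm := max_lt (hlt α hα) (hlt β hβ)
    exact hρle _ _ hm (hinter _ hm α β hne (hmono _ _ (le_max_left _ _) hm (hρmem _ (hlt α hα)))
      (hmono _ _ (le_max_right _ _) hm (hρmem _ (hlt β hβ))) x hx)
  · exact hρle _ _ (hlt α hα) (hsub _ (hlt α hα) α hμ (hρmem _ (hlt α hα)) x hx)

end Rankings

/-! ### Closure under set-valued operations -/

section ClosedSets

variable {V : Type u} (F : V → V → Set V)

/-- A set is closed under the set-valued binary operation `F`. -/
def IsClosedUnder (T : Set V) : Prop :=
  ∀ v ∈ T, ∀ w ∈ T, F v w ⊆ T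

/-- The least superset of `S` that is closed under the set-valued operation `F`. -/
def closureUnder (S : Set V) : Set V :=
  ⋂₀ {T | S ⊆ T ∧ IsClosedUnder F T}

theorem subset_closureUnder (S : Set V) : S ⊆ closureUnder F S :=
  Set.subset_sInter fun _ hT => hT.1

theorem isClosedUnder_closureUnder (S : Set V) : IsClosedUnder F (closureUnder F S) :=
  fun v hv w hw => Set.subset_sInter fun T hT => hT.2 v (hv T hT) w (hw T hT)

theorem closureUnder_mono {S S' : Set V} (h : S ⊆ S') : closureUnder F S ⊆ closureUnder F S' :=
  Set.sInter_subset_sInter fun _ hT => ⟨h.trans hT.1, hT.2⟩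

theorem mk_closureUnder_le {μ : Cardinal.{u}} (hμ : ℵ₀ ≤ μ) (hF : ∀ v w, #(F v w) ≤ μ)
    (S : Set V) : #(closureUnder F S) ≤ max #S μ := by
  set c := max #S μ with hc
  have hcω : ℵ₀ ≤ c := hμ.trans (le_max_right _ _)
  let next : Set V → Set V := fun T => T ∪ ⋃ p : T × T, F p.1 p.2
  have hnext : ∀ T : Set V, #T ≤ c → #(next T) ≤ c := fun T hT => by
    refine (mk_union_le _ _).trans (add_le_of_le hcω hT ?_)
    refine (mk_iUnion_le _).trans (mul_le_of_le hcω ?_ ?_)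
    · rw [← mul_def]
      exact mul_le_of_le hcω hT hT
    · exact ciSup_le' fun p => (hF _ _).trans (le_max_right _ _)
  let stage : ℕ → Set V := fun k => next^[k] S
  have hstage : ∀ k, stage (k + 1) = next (stage k) := fun k =>
    Function.iterate_succ_apply' next k S
  have hcard : ∀ k, #(stage k) ≤ c := by
    intro k
    induction k with
    | zero => exact le_max_left _ _
    | succ k ih => rw [hstage]; exact hnext _ ih
  have hmono : Monotone stage := monotone_nat_of_le_succ fun k => by
    rw [hstage]; exact Set.subset_union_left
  have hsub : closureUnder F S ⊆ ⋃ k : ULift.{u} ℕ, stage k.down := by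
    refine Set.sInter_subset_of_mem ⟨fun v hv => Set.mem_iUnion.2 ⟨⟨0⟩, hv⟩, ?_⟩
    intro v hv w hw y hy
    obtain ⟨⟨i⟩, hi⟩ := Set.mem_iUnion.1 hv
    obtain ⟨⟨j⟩, hj⟩ := Set.mem_iUnion.1 hw
    refine Set.mem_iUnion.2 ⟨⟨max i j + 1⟩, ?_⟩
    change y ∈ stage (max i j + 1)
    rw [hstage]
    exact Or.inr (Set.mem_iUnion.2 ⟨(⟨v, hmono (le_max_left i j) hi⟩,
      ⟨w, hmono (le_max_right i j) hj⟩), hy⟩)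
  refine (mk_le_mk_of_subset hsub).trans ((mk_iUnion_le _).trans (mul_le_of_le hcω ?_ ?_))
  · simpa using hcω
  · exact ciSup_le' fun k => hcard k.down

end ClosedSets

/-! ### Rankings from closed chains, and the point-finite case -/

section CommonPoints

variable {ι X : Type u} (A : ι → Set X) (σ μ : Cardinal.{u})

/-- The points common to all members `A α` with `α` in the index part of `s`, provided that this
part contains two indices or a member of size at most `μ`; otherwise the empty set. A set of indices
and points that is closed under `s ↦ commonPoints A μ s`, already for `s` with at most two elements,
contains the intersections of its members and its small members. -/
def commonPoints (s : Set (ι ⊕ X)) : Set X :=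
  {x | ((∃ α β, α ≠ β ∧ Sum.inl α ∈ s ∧ Sum.inl β ∈ s) ∨ ∃ α, Sum.inl α ∈ s ∧ #(A α) ≤ μ) ∧
    ∀ α, Sum.inl α ∈ s → x ∈ A α}

variable {A σ μ}

theorem mk_commonPoints_le (hσμ : σ ≤ μ) (hA : ∀ α β, α ≠ β → #(A α ∩ A β : Set X) ≤ σ)
    (s : Set (ι ⊕ X)) : #(commonPoints A μ s) ≤ μ := by
  by_cases h : (∃ α β, α ≠ β ∧ Sum.inl α ∈ s ∧ Sum.inl β ∈ s) ∨ ∃ α, Sum.inl α ∈ s ∧ #(A α) ≤ μ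
  · rcases h with ⟨α, β, hne, hα, hβ⟩ | ⟨α, hα, hμ⟩
    · have hsub : commonPoints A μ s ⊆ A α ∩ A β := fun x hx => ⟨hx.2 α hα, hx.2 β hβ⟩
      exact (mk_le_mk_of_subset hsub).trans ((hA α β hne).trans hσμ)
    · have hsub : commonPoints A μ s ⊆ A α := fun x hx => hx.2 α hα
      exact (mk_le_mk_of_subset hsub).trans hμ
  · have : commonPoints A μ s = ∅ := Set.eq_empty_of_forall_notMem fun x hx => h hx.1
    simp [this]

theorem mem_commonPoints_pair {α β : ι} (hne : α ≠ β) {x : X} (hx : x ∈ A α ∩ A β) :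
    x ∈ commonPoints A μ {Sum.inl α, Sum.inl β} := by
  refine ⟨Or.inl ⟨α, β, hne, by simp, by simp⟩, ?_⟩
  rintro γ (h | h)
  · exact Sum.inl_injective h ▸ hx.1
  · exact Sum.inl_injective h ▸ hx.2

theorem mem_commonPoints_singleton {α : ι} (hμ : #(A α) ≤ μ) {x : X} (hx : x ∈ A α) :
    x ∈ commonPoints A μ {Sum.inl α, Sum.inl α} := by
  refine ⟨Or.inr ⟨α, by simp, hμ⟩, ?_⟩
  rintro γ (h | h) <;> exact Sum.inl_injective h ▸ hx

theorem hasRanking_of_commonPoints_closed {K : Set ι} (hK : K.Nonempty) {o : Ordinal.{u}}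
    {N : Ordinal.{u} → Set (ι ⊕ X)}
    (hmono : ∀ ξ η, ξ ≤ η → η < o → N ξ ⊆ N η)
    (hcard : ∀ ξ < o, #(N ξ) < #K)
    (hcover : ∀ α ∈ K, ∃ ξ < o, Sum.inl α ∈ N ξ)
    (hclosed : ∀ ξ < o, ∀ v ∈ N ξ, ∀ w ∈ N ξ, Sum.inr '' commonPoints A μ {v, w} ⊆ N ξ)
    (hold : ∀ ξ < o, ∀ α, Sum.inl α ∈ N ξ → (∀ η < ξ, Sum.inl α ∉ N η) →
      #{x ∈ A α | ∃ η < ξ, Sum.inr x ∈ N η} ≤ σ) :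
    HasRanking A σ μ K :=
  HasRanking.of_chain hK hmono hcard hcover
    (fun ξ hξ _ _ hne hα hβ _ hx =>
      hclosed ξ hξ _ hα _ hβ (Set.mem_image_of_mem _ (mem_commonPoints_pair hne hx)))
    (fun ξ hξ _ hμ hα _ hx =>
      hclosed ξ hξ _ hα _ hα (Set.mem_image_of_mem _ (mem_commonPoints_singleton hμ hx)))
    hold

/-- For a point-finite family, a set of points and indices closed under `x ↦ {α | x ∈ A α}` meets
no member whose index it omits, so the chain of closures of initial segments gives a ranking. -/
theorem hasRanking_of_pointFinite (hσ : ℵ₀ ≤ σ) (hσμ : σ ≤ μ)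
    (hfin : ∀ x, {α | x ∈ A α}.Finite)
    (hA : ∀ α β, α ≠ β → #(A α ∩ A β : Set X) ≤ σ) {K : Set ι} (hK : μ < #K) :
    HasRanking A σ μ K := by
  have hμ : ℵ₀ ≤ μ := hσ.trans hσμ
  let F : ι ⊕ X → ι ⊕ X → Set (ι ⊕ X) := fun v w =>
    Sum.inr '' commonPoints A μ {v, w} ∪ {u | ∃ x α, v = Sum.inr x ∧ u = Sum.inl α ∧ x ∈ A α}
  have hF : ∀ v w, #(F v w) ≤ μ := fun v w => by
    refine (mk_union_le _ _).trans (add_le_of_le hμ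
      (mk_image_le.trans (mk_commonPoints_le hσμ hA _)) (le_trans ?_ hμ))
    rcases v with α | x
    · simp
    · refine le_aleph0_iff_set_countable.2 ((((hfin x).image Sum.inl).subset ?_).countable)
      rintro _ ⟨y, α, hy, rfl, hα⟩
      exact ⟨α, by rwa [Set.mem_ofPred_eq, Sum.inr_injective hy], rfl⟩
  obtain ⟨f, hf, hlt⟩ := exists_rank_lt_ord K
  let S : Ordinal.{u} → Set (ι ⊕ X) := fun ξ => Sum.inl '' {α ∈ K | f α ≤ ξ}
  have hS : Monotone S := fun ξ η h => Set.image_mono fun α hα => ⟨hα.1, hα.2.trans h⟩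
  have hcl := fun ξ => isClosedUnder_closureUnder F (S ξ)
  have hKω : ℵ₀ ≤ #K := hμ.trans hK.le
  refine hasRanking_of_commonPoints_closed (o := (#K).ord) (N := fun ξ => closureUnder F (S ξ))
    (mk_set_ne_zero_iff.1 ?_) (fun ξ η h _ => closureUnder_mono F (hS h)) (fun ξ hξ => ?_)
    (fun α hα => ⟨f α, hlt α hα, subset_closureUnder _ _ ⟨α, ⟨hα, le_rfl⟩, rfl⟩⟩)
    (fun ξ _ v hv w hw => Set.subset_union_left.trans (hcl ξ v hv w hw))
    (fun ξ _ α _ hα => ?_)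
  · exact (aleph0_pos.trans_le hKω).ne'
  · refine (mk_closureUnder_le F hμ hF _).trans_lt (max_lt ?_ hK)
    refine mk_image_le.trans_lt ?_
    refine (mk_le_card_of_injOn (hf.mono fun β hβ => hβ.1) (o := succ ξ)
      fun β hβ => Order.lt_succ_iff.2 hβ.2).trans_lt ?_
    exact lt_ord.1 ((isSuccLimit_ord hKω).succ_lt hξ)
  · have : {x ∈ A α | ∃ η < ξ, Sum.inr x ∈ closureUnder F (S η)} = ∅ := by
      refine Set.eq_empty_of_forall_notMem ?_
      rintro x ⟨hx, η, hη, hm⟩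
      exact hα η hη (hcl η _ hm _ hm (Or.inr ⟨x, α, rfl, rfl, hx⟩))
    simp [this]

end CommonPoints

/-! ### Elementary submodels of `H(Θ)` -/

namespace Ceca

open FirstOrder FirstOrder.Language

section Absoluteness

variable {Θ : Cardinal.{u}} {M : ZFSet.{u}}

theorem mem_H_of_mem {a b : ZFSet.{u}} (hb : b ∈ H Θ) (hab : a ∈ b) : a ∈ H Θ := by
  obtain ⟨t, ht, hbt, hc⟩ := hb
  exact ⟨t, ht, ht _ (hbt hab), hc⟩

theorem pair_mem_H (hΘ : ℵ₀ ≤ Θ) {a b : ZFSet.{u}} (ha : a ∈ H Θ) (hb : b ∈ H Θ) :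
    ({a, b} : ZFSet.{u}) ∈ H Θ := by
  obtain ⟨t, ht, hat, hct⟩ := ha
  obtain ⟨s, hs, hbs, hcs⟩ := hb
  refine ⟨insert a (insert b (t ∪ s)), ?_, ?_, ?_⟩
  · intro y hy z hz
    simp only [ZFSet.mem_insert_iff, ZFSet.mem_union] at hy ⊢
    rcases hy with rfl | rfl | hy | hy
    · exact Or.inr (Or.inr (Or.inl (hat hz)))
    · exact Or.inr (Or.inr (Or.inr (hbs hz)))
    · exact Or.inr (Or.inr (Or.inl (ht y hy hz)))
    · exact Or.inr (Or.inr (Or.inr (hs y hy hz)))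
  · intro z hz
    simp only [ZFSet.mem_insert_iff, ZFSet.mem_singleton] at hz ⊢
    rcases hz with rfl | rfl <;> simp
  · refine ZFSet.card_insert_le.trans_lt (add_lt_of_lt hΘ (ZFSet.card_insert_le.trans_lt
      (add_lt_of_lt hΘ (ZFSet.card_union_le.trans_lt (add_lt_of_lt hΘ hct hcs)) ?_)) ?_) <;>
    exact one_lt_aleph0.trans_le hΘ

theorem IsElementarySubmodel.mem_H (hM : IsElementarySubmodel Θ M) {a : ZFSet.{u}} (ha : a ∈ M) :
    a ∈ H Θ := by
  obtain ⟨S, hS⟩ := hM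
  obtain ⟨y, -, rfl⟩ := (hS a).1 ha
  exact y.2

/-- The Tarski–Vaught property: a formula with parameters `a`, `b` in `M ≺ H(Θ)` that has a solution
in `H(Θ)` has one in `M`. -/
theorem IsElementarySubmodel.exists_realize (hM : IsElementarySubmodel Θ M)
    (φ : setLang.BoundedFormula Empty 3) {a b : ZFSet.{u}} (ha : a ∈ M) (hb : b ∈ M)
    (h : ∃ y : H Θ, φ.Realize default ![⟨a, hM.mem_H ha⟩, ⟨b, hM.mem_H hb⟩, y]) :
    ∃ y : H Θ, (y : ZFSet.{u}) ∈ M ∧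
      φ.Realize default ![⟨a, hM.mem_H ha⟩, ⟨b, hM.mem_H hb⟩, y] := by
  have hM' := hM
  obtain ⟨S, hS⟩ := hM
  obtain ⟨a', haS, rfl⟩ := (hS a).1 ha
  obtain ⟨b', hbS, rfl⟩ := (hS b).1 hb
  obtain ⟨y, hy⟩ := h
  have key : ∀ y : H Θ, Fin.snoc (α := fun _ => H Θ) ![a', b'] y = ![a', b', y] := by
    intro y
    ext i
    fin_cases i <;> rfl
  have h1 : φ.ex.Realize (default : Empty → H Θ) ![a', b'] := by
    rw [BoundedFormula.realize_ex]
    exact ⟨y, by rw [key]; exact hy⟩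
  have h2 := (S.subtype.map_boundedFormula φ.ex (default : Empty → S)
    ![⟨a', haS⟩, ⟨b', hbS⟩]).1 (by
      convert h1 using 1
      ext i
      fin_cases i <;> rfl)
  rw [BoundedFormula.realize_ex] at h2
  obtain ⟨z, hz⟩ := h2
  refine ⟨z, (hS z).2 ⟨z, z.2, rfl⟩, ?_⟩
  have h3 := (S.subtype.map_boundedFormula φ _ _).2 hz
  convert h3 using 1
  ext i
  fin_cases i <;> rfl

/-- The symbol for membership. -/
def memSym : setLang.Relations 2 := MemRel.mem

/-- The atomic formula saying that the `i`-th variable is an element of the `j`-th. -/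
def memFormula {k : ℕ} (i j : Fin k) : setLang.BoundedFormula Empty k :=
  memSym.boundedFormula₂ (Term.var (Sum.inr i))
    (Term.var (Sum.inr j))

@[simp]
theorem realize_memFormula {k : ℕ} (i j : Fin k) (v : Empty → H Θ) (xs : Fin k → H Θ) :
    (memFormula i j).Realize v xs ↔ (xs i : ZFSet.{u}) ∈ (xs j : ZFSet.{u}) := by
  exact BoundedFormula.realize_rel₂.trans Iff.rfl

/-- The atomic formula saying that the `i`-th variable equals the `j`-th. -/
def eqFormula {k : ℕ} (i j : Fin k) : setLang.BoundedFormula Empty k :=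
  Term.bdEqual (Term.var (Sum.inr i)) (Term.var (Sum.inr j))

@[simp]
theorem realize_eqFormula {k : ℕ} (i j : Fin k) (v : Empty → H Θ) (xs : Fin k → H Θ) :
    (eqFormula i j).Realize v xs ↔ xs i = xs j := by
  simp [eqFormula]

theorem IsElementarySubmodel.exists_mem_mem (hM : IsElementarySubmodel Θ M) {a b y : ZFSet.{u}}
    (ha : a ∈ M) (hb : b ∈ M) (hay : a ∈ y) (hyb : y ∈ b) : ∃ y ∈ M, a ∈ y ∧ y ∈ b := by
  obtain ⟨z, hz, hr⟩ := hM.exists_realize (memFormula 0 2 ⊓ memFormula 2 1) ha hb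
    ⟨⟨y, mem_H_of_mem (hM.mem_H hb) hyb⟩, by simp [hay, hyb]⟩
  exact ⟨z, hz, by simpa using hr⟩

theorem IsElementarySubmodel.exists_mem_ne (hM : IsElementarySubmodel Θ M) {a b y : ZFSet.{u}}
    (ha : a ∈ M) (hb : b ∈ M) (hya : y ≠ a) (hyb : y ∈ b) : ∃ y ∈ M, y ≠ a ∧ y ∈ b := by
  obtain ⟨z, hz, hr⟩ := hM.exists_realize ((eqFormula 2 0).not ⊓ memFormula 2 1) ha hb
    ⟨⟨y, mem_H_of_mem (hM.mem_H hb) hyb⟩, by simp [hya, hyb]⟩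
  refine ⟨z, hz, ?_⟩
  simpa [Subtype.ext_iff] using hr

theorem IsElementarySubmodel.mem_of_upair_mem (hM : IsElementarySubmodel Θ M) {a b : ZFSet.{u}}
    (hab : ({a, b} : ZFSet.{u}) ∈ M) : a ∈ M ∧ b ∈ M := by
  -- Some element `z` of `{a, b}` is in `M`; the other one is then obtained with `z` as a parameter.
  obtain ⟨z, hzM, -, hz⟩ := hM.exists_mem_ne hab hab (y := a)
    (fun h => ZFSet.mem_irrefl a ((ZFSet.ext_iff.1 h a).2 (by simp))) (by simp)
  have key : ∀ y ∈ ({a, b} : ZFSet.{u}), y ∈ M := by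
    intro y hy
    by_cases hyz : y = z
    · rwa [hyz]
    obtain ⟨w, hwM, hwz, hw⟩ := hM.exists_mem_ne hzM hab hyz hy
    rw [ZFSet.mem_pair] at hy hz hw
    have hwy : w = y := by grind
    rwa [← hwy]
  exact ⟨key a (by simp), key b (by simp)⟩

theorem IsElementarySubmodel.upair_mem (hΘ : ℵ₀ ≤ Θ) (hM : IsElementarySubmodel Θ M)
    {a b : ZFSet.{u}} (ha : a ∈ M) (hb : b ∈ M) : ({a, b} : ZFSet.{u}) ∈ M := by
  obtain ⟨z, hz, hr⟩ := hM.exists_realize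
    ((memFormula (k := 4) 3 2).iff (eqFormula 3 0 ⊔ eqFormula 3 1)).all ha hb
    ⟨⟨{a, b}, pair_mem_H hΘ (hM.mem_H ha) (hM.mem_H hb)⟩, by
      rw [BoundedFormula.realize_all]
      intro x
      simp [Subtype.ext_iff]⟩
  rw [BoundedFormula.realize_all] at hr
  have : (z : ZFSet.{u}) = {a, b} := by
    ext x
    have hx : ∀ hxH : x ∈ H Θ, x ∈ (z : ZFSet.{u}) ↔ x = a ∨ x = b := fun hxH => by
      simpa [Fin.snoc, Subtype.ext_iff] using hr ⟨x, hxH⟩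
    rw [ZFSet.mem_pair]
    constructor
    · intro h
      exact (hx (mem_H_of_mem z.2 h)).1 h
    · rintro (rfl | rfl)
      · exact (hx (hM.mem_H ha)).2 (Or.inl rfl)
      · exact (hx (hM.mem_H hb)).2 (Or.inr rfl)
  rwa [← this]

theorem IsElementarySubmodel.singleton_mem (hΘ : ℵ₀ ≤ Θ) (hM : IsElementarySubmodel Θ M)
    {a : ZFSet.{u}} (ha : a ∈ M) : ({a} : ZFSet.{u}) ∈ M := by
  rw [← ZFSet.pair_eq_singleton]
  exact hM.upair_mem hΘ ha ha

theorem IsElementarySubmodel.pair_mem (hΘ : ℵ₀ ≤ Θ) (hM : IsElementarySubmodel Θ M)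
    {a b : ZFSet.{u}} (ha : a ∈ M) (hb : b ∈ M) : ZFSet.pair a b ∈ M :=
  hM.upair_mem hΘ (hM.singleton_mem hΘ ha) (hM.upair_mem hΘ ha hb)

/-- An elementary submodel is closed under application of its functions. -/
theorem IsElementarySubmodel.apply_mem (hΘ : ℵ₀ ≤ Θ) (hM : IsElementarySubmodel Θ M)
    {G k y : ZFSet.{u}} (hG : G ∈ M) (hk : k ∈ M) (hy : ZFSet.pair k y ∈ G)
    (hpair : ∀ p ∈ G, ∃ k' y', p = ZFSet.pair k' y')
    (hfun : ∀ y', ZFSet.pair k y' ∈ G → y' = y) : y ∈ M := by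
  have hk' := hM.singleton_mem hΘ hk
  by_cases hyk : y = k
  · rwa [hyk]
  -- `pair k y = {{k}, {k, y}}` is the only element of `G` that contains `{k}`.
  obtain ⟨p, hpM, hkp, hpG⟩ := hM.exists_mem_mem hk' hG (y := ZFSet.pair k y)
    (by simp [ZFSet.pair]) hy
  obtain ⟨k', y', rfl⟩ := hpair p hpG
  have hkk : k' = k := by
    rw [ZFSet.pair, ZFSet.mem_pair, ZFSet.singleton_inj, ZFSet.singleton_eq_pair_iff] at hkp
    rcases hkp with h | h
    · exact h.symm
    · exact h.1.symm
  subst hkk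
  rw [hfun y' hpG] at hpM
  -- Then `{k, y}` is its only element other than `{k}`, and `y` that of `{k, y}` other than `k`.
  obtain ⟨w, hwM, hw, hwp⟩ := hM.exists_mem_ne hk' hpM (y := {k', y})
    (fun h => hyk (ZFSet.pair_eq_singleton_iff.1 h).2) (by simp [ZFSet.pair])
  rw [ZFSet.pair, ZFSet.mem_pair] at hwp
  obtain rfl := hwp.resolve_left hw
  obtain ⟨z, hzM, hz, hzw⟩ := hM.exists_mem_ne hk hwM (y := y) hyk (by simp)
  rw [ZFSet.mem_pair] at hzw
  rwa [← hzw.resolve_left hz]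

end Absoluteness

end Ceca

/-! ### Codes in the universe of sets, and chains of closed sets from CECA -/

namespace Ceca

section Coding

variable {V : Type u} {e : V → ZFSet.{u}}

theorem exists_injective_zfset (V : Type u) : ∃ e : V → ZFSet.{u}, Function.Injective e := by
  obtain ⟨f, hf, -⟩ := exists_rank_lt_ord (Set.univ : Set V)
  exact ⟨fun v => (f v).toZFSet, Ordinal.toZFSet_injective.comp (Set.injOn_univ.1 hf)⟩

/-- The set in the universe of sets that corresponds to `s : Set V` under the coding `e`. -/
noncomputable def code (e : V → ZFSet.{u}) (s : Set V) : ZFSet.{u} :=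
  ZFSet.range fun v : s => e v

theorem mem_code {s : Set V} {a : ZFSet.{u}} : a ∈ code e s ↔ ∃ v ∈ s, e v = a := by
  simp [code]

theorem code_pair (v w : V) : code e {v, w} = {e v, e w} := by
  ext a
  simp [mem_code, eq_comm]

theorem code_subset {s : Set V} {M : ZFSet.{u}} (h : ∀ v ∈ s, e v ∈ M) : code e s ⊆ M := by
  intro a ha
  obtain ⟨v, hv, rfl⟩ := mem_code.1 ha
  exact h v hv

theorem code_injective (he : Function.Injective e) : Function.Injective (code e) := by
  have key : ∀ {s t : Set V}, code e s = code e t → s ⊆ t := by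
    intro s t h v hv
    obtain ⟨w, hw, hwv⟩ := mem_code.1 (h ▸ mem_code.2 ⟨v, hv, rfl⟩)
    exact he hwv ▸ hw
  exact fun s t h => (key h).antisymm (key h.symm)

theorem card_code (he : Function.Injective e) (s : Set V) : (code e s).card = #s := by
  have h : lift.{u} #(Set.range fun v : s => e v) = lift.{u + 1} #s :=
    mk_range_eq_of_injective (he.comp Subtype.val_injective)
  rw [← ZFSet.coe_range] at h
  have h2 := ZFSet.cardinalMk_coe_sort (x := code e s)
  rw [← lift_inj.{u, u + 1}, ← h2, ← h]
  exact (lift_id'.{u, u + 1} _).symm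

theorem mk_preimage_le_card (he : Function.Injective e) (M : ZFSet.{u}) :
    #{v | e v ∈ M} ≤ M.card := by
  rw [← card_code he]
  exact ZFSet.card_mono (code_subset fun v hv => hv)

theorem IsWeaklyClosed.exists_subset (he : Function.Injective e) {M : ZFSet.{u}}
    (hM : IsWeaklyClosed M) {τ : Cardinal.{u}} (hτ : τ.IsRegular) {I : Set V}
    (hI : ∀ v ∈ I, e v ∈ M) (hc : #I = τ) :
    ∃ J ⊆ I, #J = τ ∧ ∀ K ⊆ J, #K < τ → code e K ∈ M := by
  obtain ⟨J, hJI, hJ, hK⟩ := hM τ hτ (code e I) (code_subset hI) (by rw [card_code he, hc])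
  have hJc : code e {v | e v ∈ J} = J := by
    ext a
    rw [mem_code]
    constructor
    · rintro ⟨v, hv, rfl⟩
      exact hv
    · intro ha
      obtain ⟨v, -, rfl⟩ := mem_code.1 (hJI ha)
      exact ⟨v, ha, rfl⟩
  refine ⟨{v | e v ∈ J}, fun v hv => ?_, by rw [← card_code he, hJc, hJ], fun K hKJ hc => ?_⟩
  · obtain ⟨w, hw, hwv⟩ := mem_code.1 (hJI hv)
    exact he hwv ▸ hw
  · exact hK _ (code_subset hKJ) (by rwa [card_code he])

/-- The graph of the three-place function `g`, whose arguments are the codes of two sets and the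
code of an element. -/
noncomputable def codedGraph (e : V → ZFSet.{u}) (g : Set V → Set V → V → V) : ZFSet.{u} :=
  ZFSet.range fun p : Set V × Set V × V =>
    ZFSet.pair (ZFSet.pair (code e p.1) (ZFSet.pair (code e p.2.1) (e p.2.2)))
      (e (g p.1 p.2.1 p.2.2))

theorem IsElementarySubmodel.apply_codedGraph_mem (he : Function.Injective e)
    {Θ : Cardinal.{u}} (hΘ : ℵ₀ ≤ Θ) {M : ZFSet.{u}} (hM : IsElementarySubmodel Θ M)
    {g : Set V → Set V → V → V} (hG : codedGraph e g ∈ M) {s C : Set V} {c : V}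
    (hs : code e s ∈ M) (hC : code e C ∈ M) (hc : e c ∈ M) : e (g s C c) ∈ M := by
  refine hM.apply_mem hΘ hG (hM.pair_mem hΘ hs (hM.pair_mem hΘ hC hc))
    (ZFSet.mem_range.2 ⟨(s, C, c), rfl⟩) ?_ ?_
  · intro p hp
    obtain ⟨q, rfl⟩ := ZFSet.mem_range.1 hp
    exact ⟨_, _, rfl⟩
  · intro y' hy'
    obtain ⟨⟨s', C', c'⟩, hq⟩ := ZFSet.mem_range.1 hy'
    simp only [ZFSet.pair_inj] at hq
    obtain ⟨⟨h1, h2, h3⟩, rfl⟩ := hq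
    rw [code_injective he h1, code_injective he h2, he h3]

/-- If every `T s` has size at most `μ`, there is one function `g` such that `g s C` maps `C` onto a
superset of `T s` whenever `C` has size `μ`. -/
theorem exists_uniform_surjection {μ : Cardinal.{u}} (T : Set V → Set V) (hT : ∀ s, #(T s) ≤ μ) :
    ∃ g : Set V → Set V → V → V,
      ∀ s C : Set V, #C = μ → ∀ y ∈ T s, ∃ c ∈ C, g s C c = y := by
  have h : ∀ s C : Set V, ∃ f : V → V, #C = μ → ∀ y ∈ T s, ∃ c ∈ C, f c = y := by
    intro s C
    by_cases hC : #C = μ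
    · obtain ⟨i⟩ : Nonempty (T s ↪ C) := by
        rw [← Cardinal.le_def, hC]
        exact hT s
      refine ⟨Function.extend (fun y : T s => (i y : V)) Subtype.val id, fun _ y hy =>
        ⟨i ⟨y, hy⟩, (i _).2, ?_⟩⟩
      exact (Subtype.val_injective.comp i.injective).extend_apply _ _ (⟨y, hy⟩ : T s)
    · exact ⟨id, fun h => (hC h).elim⟩
  choose g hg using h
  exact ⟨g, hg⟩

/-- A single stage of the chain contains a set of size `μ` both as an element and as a subset. If
the cofinality of the length exceeds `μ`, any set of size `μ` that belongs to the first stage and is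
covered by the chain will do. Otherwise the chain has at most `μ` stages, so that some stage has
more than `μ` elements, and weak closedness at `μ⁺` provides such a set. -/
theorem exists_code_mem_of_chain (he : Function.Injective e) {W C₀ : Set V} {μ : Cardinal.{u}}
    (hμ : ℵ₀ ≤ μ) (hW : μ < #W) (hC₀W : C₀ ⊆ W) (hC₀ : #C₀ = μ) {M : Ordinal.{u} → ZFSet.{u}}
    (hmono : ∀ ξ η, ξ ≤ η → η < (#W).ord.cof.ord → M ξ ⊆ M η)
    (hclosed : ∀ ξ < (#W).ord.cof.ord, IsWeaklyClosed (M ξ))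
    (hcover : ∀ v ∈ W, ∃ ξ < (#W).ord.cof.ord, e v ∈ M ξ) (hmem : code e C₀ ∈ M 0) :
    ∃ ξ < (#W).ord.cof.ord, ∃ C : Set V, #C = μ ∧ code e C ∈ M ξ ∧ ∀ c ∈ C, e c ∈ M ξ := by
  set o := (#W).ord.cof.ord with ho
  have hreg : (#W).ord.cof.IsRegular := isRegular_cof (isSuccLimit_ord (hμ.trans hW.le))
  by_cases hcof : μ < (#W).ord.cof
  · choose f hfo hf using hcover
    let f' : C₀ → Ordinal.{u} := fun c => f c (hC₀W c.2)
    have hsup : iSup f' < o := by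
      refine Ordinal.iSup_lt_of_lt_cof ?_ fun c => hfo _ _
      rwa [ho, hreg.cof_ord, hC₀]
    exact ⟨iSup f', hsup, C₀, hC₀, hmono _ _ zero_le hsup hmem, fun c hc =>
      hmono _ _ (Ordinal.le_iSup f' ⟨c, hc⟩) hsup (hf c (hC₀W hc))⟩
  · obtain ⟨ξ, hξ, hbig⟩ : ∃ ξ < o, μ < #{v | e v ∈ M ξ} := by
      by_contra! hsmall
      refine hW.not_ge ?_
      have hsub : W ⊆ ⋃ i : o.ToType, {v | e v ∈ M (Ordinal.ToType.toOrd i)} := by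
        intro v hv
        obtain ⟨ξ, hξ, hm⟩ := hcover v hv
        exact Set.mem_iUnion.2 ⟨Ordinal.ToType.mk ⟨ξ, hξ⟩, by simpa using hm⟩
      refine (mk_le_mk_of_subset hsub).trans ((mk_iUnion_le _).trans (mul_le_of_le hμ ?_ ?_))
      · rw [mk_toType, ho, card_ord]
        exact not_lt.1 hcof
      · exact ciSup_le' fun i => hsmall _ (Ordinal.ToType.toOrd i).2
    obtain ⟨I, hI, hIc⟩ := le_mk_iff_exists_subset.1 (succ_le_of_lt hbig)
    obtain ⟨J, hJI, hJ, hK⟩ := (hclosed ξ hξ).exists_subset he (isRegular_succ hμ) hI hIc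
    obtain ⟨C, hCJ, hC⟩ := le_mk_iff_exists_subset.1 ((le_succ μ).trans hJ.ge)
    exact ⟨ξ, hξ, C, hC, hK C hCJ (hC.trans_lt (lt_succ μ)), fun c hc => hI (hJI (hCJ hc))⟩

/-- A combinatorial form of CECA, free of models: a set `W` of size greater than `μ` is covered by a
continuous chain of sets `N ξ` smaller than `W` and closed under the operation `T` in two ways.
For any two elements `v`, `w` of `N ξ`, `T {v, w}` is included in `N ξ`. A subset of `N ξ` of
regular size `τ` can be thinned out to one of the same size, all of whose subsets `K` of size less than `τ`
satisfy `T K ⊆ N ξ`. -/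
theorem CECA.exists_chain (hceca : CECA.{u}) {W : Set V} {μ : Cardinal.{u}} (hμ : ℵ₀ ≤ μ)
    (hW : μ < #W) (T : Set V → Set V) (hT : ∀ s, #(T s) ≤ μ) :
    ∃ (o : Ordinal.{u}) (N : Ordinal.{u} → Set V),
      (∀ ξ η, ξ ≤ η → η < o → N ξ ⊆ N η) ∧
      (∀ δ < o, IsSuccLimit δ → ∀ v ∈ N δ, ∃ ξ < δ, v ∈ N ξ) ∧
      (∀ ξ < o, #(N ξ) < #W) ∧
      (∀ v ∈ W, ∃ ξ < o, v ∈ N ξ) ∧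
      (∀ ξ < o, ∀ v ∈ N ξ, ∀ w ∈ N ξ, T {v, w} ⊆ N ξ) ∧
      ∀ ξ < o, ∀ τ : Cardinal.{u}, τ.IsRegular → ∀ I ⊆ N ξ, #I = τ →
        ∃ J ⊆ I, #J = τ ∧ ∀ K ⊆ J, #K < τ → T K ⊆ N ξ := by
  obtain ⟨e, he⟩ := exists_injective_zfset V
  obtain ⟨g, hg⟩ := exists_uniform_surjection T hT
  obtain ⟨C₀, hC₀W, hC₀⟩ := le_mk_iff_exists_subset.1 hW.le
  set B : ZFSet.{u} := {codedGraph e g, code e C₀} with hB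
  let t : ZFSet.{u} := ZFSet.vonNeumann (max (code e W).rank B.rank)
  set Θ : Cardinal.{u} := succ (max #W t.card) with hΘ
  have hWω : ℵ₀ < #W := hμ.trans_lt hW
  have hΘω : ℵ₀ ≤ Θ := (hWω.le.trans (le_max_left _ _)).trans (le_succ _)
  have hH : ∀ x : ZFSet.{u}, x.rank ≤ max (code e W).rank B.rank → x ∈ H Θ := fun x hx =>
    ⟨t, ZFSet.isTransitive_vonNeumann _, ZFSet.subset_vonNeumann.2 hx,
      (le_max_right _ _).trans_lt (lt_succ _)⟩
  obtain ⟨M, hchain, hcont, hM, hBM, hcover⟩ := hceca #W hWω Θ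
    (isRegular_succ (hWω.le.trans (le_max_left _ _)))
    ((le_max_left _ _).trans_lt (lt_succ _)) (code e W) B
    (hH _ (le_max_left _ _)) (hH _ (le_max_right _ _)) (card_code he W)
    (ZFSet.card_insert_le.trans_lt (add_lt_of_lt hWω.le
      (by rw [ZFSet.card_singleton]; exact one_lt_aleph0.trans hWω)
      (one_lt_aleph0.trans hWω)))
  set o := (#W).ord.cof.ord with ho
  have hopos : 0 < o := (isRegular_cof (isSuccLimit_ord hWω.le)).ord_pos
  have hmono : ∀ ξ η, ξ ≤ η → η < o → M ξ ⊆ M η := by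
    intro ξ η h hη
    rcases h.eq_or_lt with rfl | h
    · exact fun _ h => h
    · exact hchain.1 ξ η h hη
  have hcover' : ∀ v ∈ W, ∃ ξ < o, e v ∈ M ξ := fun v hv => hcover _ (mem_code.2 ⟨v, hv, rfl⟩)
  obtain ⟨hG, hC₀M⟩ := (hM 0 hopos).2.1.mem_of_upair_mem hBM
  obtain ⟨ξ₀, hξ₀, C, hC, hCM, hCsub⟩ := exists_code_mem_of_chain he hμ hW hC₀W hC₀ hmono
    (fun ξ hξ => (hM ξ hξ).1) hcover' hC₀M
  have hT' : ∀ ξ < o, ξ₀ ≤ ξ → ∀ s, code e s ∈ M ξ → ∀ y ∈ T s, e y ∈ M ξ := by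
    intro ξ hξ hle s hs y hy
    obtain ⟨c, hc, rfl⟩ := hg s C hC y hy
    exact (hM ξ hξ).2.1.apply_codedGraph_mem he hΘω (hmono _ _ zero_le hξ hG) hs
      (hmono _ _ hle hξ hCM) (hmono _ _ hle hξ (hCsub c hc))
  have hmax : ∀ ξ < o, max ξ ξ₀ < o := fun ξ hξ => max_lt hξ hξ₀
  -- The stages before `ξ₀` are replaced by the stage `ξ₀`.
  refine ⟨o, fun ξ => {v | e v ∈ M (max ξ ξ₀)}, fun ξ η h hη v hv => ?_, fun δ hδ hlim v hv => ?_,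
    fun ξ hξ => ?_, fun v hv => ?_, fun ξ hξ v hv w hw y hy => ?_, fun ξ hξ τ hτ I hI hIc => ?_⟩
  · exact hmono _ _ (max_le_max_right _ h) (hmax η hη) hv
  · rcases le_or_gt δ ξ₀ with h | h
    · refine ⟨0, hlim.bot_lt, ?_⟩
      simpa [max_eq_right h] using hv
    · have hv' : e v ∈ M δ := by simpa [max_eq_left h.le] using hv
      obtain ⟨ξ, hξ, hm⟩ := (hcont δ hδ hlim _).1 hv'
      exact ⟨ξ, hξ, hmono _ _ (le_max_left _ _) (hmax _ (hξ.trans hδ)) hm⟩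
  · exact (mk_preimage_le_card he _).trans_lt (hM _ (hmax ξ hξ)).2.2
  · obtain ⟨ξ, hξ, hm⟩ := hcover' v hv
    exact ⟨ξ, hξ, hmono _ _ (le_max_left _ _) (hmax ξ hξ) hm⟩
  · refine hT' _ (hmax ξ hξ) (le_max_right _ _) {v, w} ?_ y hy
    rw [code_pair]
    exact (hM _ (hmax ξ hξ)).2.1.upair_mem hΘω hv hw
  · obtain ⟨J, hJI, hJ, hK⟩ := (hM _ (hmax ξ hξ)).1.exists_subset he hτ hI hIc
    exact ⟨J, hJI, hJ, fun K hKJ hKc y hy =>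
      hT' _ (hmax ξ hξ) (le_max_right _ _) K (hK K hKJ hKc) y hy⟩

end Coding

end Ceca

/-! ### Rankings under CECA -/

section CecaRanking

variable {ι X : Type u} {A : ι → Set X} {σ μ : Cardinal.{u}}

/-- Under CECA, a member `A α` has at most `σ` points in a stage that omits `α`: otherwise weak
closedness at `σ⁺` gives a set `S ⊆ A α` of size `σ` that belongs to the stage, and `α` is one of
the at most `σ` indices determined by `S`. -/
theorem hasRanking_of_ceca (hceca : Ceca.CECA.{u}) (hσ : ℵ₀ ≤ σ) (hσμ : σ ≤ μ)
    (hA : ∀ α β, α ≠ β → #(A α ∩ A β : Set X) ≤ σ)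
    (hS : ∀ S : Set X, #S = σ → #{α | S ⊆ A α} ≤ σ) {K : Set ι} (hK : μ < #K) :
    HasRanking A σ μ K := by
  have hμ : ℵ₀ ≤ μ := hσ.trans hσμ
  let T : Set (ι ⊕ X) → Set (ι ⊕ X) := fun s =>
    Sum.inr '' commonPoints A μ s ∪
      Sum.inl '' {α | #(Sum.inr ⁻¹' s : Set X) = σ ∧ Sum.inr ⁻¹' s ⊆ A α}
  have hT : ∀ s, #(T s) ≤ μ := fun s => by
    refine (mk_union_le _ _).trans (add_le_of_le hμ
      (mk_image_le.trans (mk_commonPoints_le hσμ hA _)) (mk_image_le.trans (le_trans ?_ hσμ)))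
    by_cases h : #(Sum.inr ⁻¹' s : Set X) = σ
    · simpa [h] using hS _ h
    · simp [h]
  have hKc : #(Sum.inl '' K : Set (ι ⊕ X)) = #K := mk_image_eq Sum.inl_injective
  obtain ⟨o, N, hmono, hcont, hcard, hcover, hpair, hweak⟩ :=
    hceca.exists_chain (W := (Sum.inl '' K : Set (ι ⊕ X))) hμ (by rwa [hKc]) T hT
  refine hasRanking_of_commonPoints_closed (mk_set_ne_zero_iff.1 ?_) hmono
    (fun ξ hξ => (hcard ξ hξ).trans_eq hKc) (fun α hα => hcover _ ⟨α, hα, rfl⟩)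
    (fun ξ hξ v hv w hw => Set.subset_union_left.trans (hpair ξ hξ v hv w hw))
    (fun ξ hξ α hα hnew => ?_)
  · exact (aleph0_pos.trans_le (hμ.trans hK.le)).ne'
  · rcases Ordinal.zero_or_succ_or_isSuccLimit ξ with rfl | ⟨η, rfl⟩ | hlim
    · simp
    · have hη : η < succ η := lt_succ η
      by_contra! hbig
      obtain ⟨I, hI, hIc⟩ := le_mk_iff_exists_subset.1 (succ_le_of_lt hbig)
      have hIN : (Sum.inr '' I : Set (ι ⊕ X)) ⊆ N η := by
        rintro _ ⟨x, hx, rfl⟩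
        obtain ⟨-, ζ, hζ, hm⟩ := hI hx
        exact hmono _ _ (Order.lt_succ_iff.1 hζ) (hη.trans hξ) hm
      obtain ⟨J, hJI, hJ, hsmall⟩ := hweak η (hη.trans hξ) (succ σ) (isRegular_succ hσ) _ hIN
        ((mk_image_eq Sum.inr_injective).trans hIc)
      obtain ⟨S, hSJ, hSc⟩ := le_mk_iff_exists_subset.1 ((le_succ σ).trans hJ.ge)
      refine hnew η hη (hsmall S hSJ (hSc.trans_lt (lt_succ σ)) (Or.inr ⟨α, ⟨?_, ?_⟩, rfl⟩))
      · rw [mk_preimage_of_injective_of_subset_range _ _ Sum.inr_injective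
          ((hSJ.trans hJI).trans (Set.image_subset_range _ _)), hSc]
      · intro x hx
        obtain ⟨y, hy, hyx⟩ := hJI (hSJ hx)
        exact Sum.inr_injective hyx ▸ (hI hy).1
    · obtain ⟨η, hη, hm⟩ := hcont ξ hξ hlim _ hα
      exact (hnew η hη hm).elim

end CecaRanking

/-! ### Multiplicities and the point-`<τ` property -/

section Multiplicity

variable {ι X : Type u} {A : ι → Set X} {σ : Cardinal.{u}}

theorem IsEssentiallyPointLE.exists_isPointLT {n : ℕ}
    (h : IsEssentiallyPointLE A σ Set.univ n) :
    ∃ A' : ι → Set X, (∀ α, A' α ⊆ A α ∧ #(A' α) ≤ σ) ∧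
      Ceca.IsPointLT (fun α => A α \ A' α) ((n : Cardinal.{u}) + 1) := by
  obtain ⟨A', hA', hx⟩ := h
  refine ⟨fun α => A α ∩ A' α, fun α => ⟨Set.inter_subset_left,
    (mk_le_mk_of_subset Set.inter_subset_right).trans (hA' α trivial)⟩, fun I hI => ?_⟩
  refine Set.eq_empty_of_forall_notMem fun x hxI => ?_
  have hsub : I ⊆ {α ∈ Set.univ | x ∈ A α \ A' α} := fun α hα => by
    have := Set.mem_iInter₂.1 hxI α hα
    exact ⟨trivial, this.1, fun h => this.2 ⟨this.1, h⟩⟩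
  have hle := (Set.encard_le_encard hsub).trans (hx x)
  have hI' : I.encard = ((n + 1 : ℕ) : ℕ∞) := by
    rw [Set.encard, ENat.card, hI]
    exact_mod_cast Cardinal.toENat_nat (n + 1)
  rw [hI'] at hle
  exact absurd (by exact_mod_cast hle : n + 1 ≤ n) (by omega)

theorem finite_of_isPointLT_aleph0 (h : Ceca.IsPointLT A ℵ₀) (x : X) : {α | x ∈ A α}.Finite := by
  by_contra hinf
  obtain ⟨I, hI, hIc⟩ := le_mk_iff_exists_subset.1
    (aleph0_le_mk_iff.2 (Set.infinite_coe_iff.2 hinf))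
  have hx : x ∈ ⋂ i ∈ I, A i := Set.mem_iInter₂.2 fun α hα => hI hα
  rw [h I hIc] at hx
  exact hx

end Multiplicity

theorem theorem3p1 {ι X : Type u} (n : ℕ) (hn : 1 ≤ n) (σ : Cardinal.{u}) (hσ : σ.IsRegular)
    (A : ι → Set X) (hA : ∀ α, #(A α) ≤ succ^[n] σ) :
    (Ceca.CECA.{u} →
      ((∀ α β, α ≠ β → #(A α ∩ A β : Set X) < σ) ∨
        ((∀ α β, α ≠ β → #(A α ∩ A β : Set X) ≤ σ) ∧
          ∀ S : Set X, S ⊆ ⋃ α, A α → #S = σ → #{α | S ⊆ A α} ≤ σ)) →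
      ∃ A' : ι → Set X, (∀ α, #(A' α) ≤ σ) ∧
        Ceca.IsPointLT (fun α => A α \ A' α) ((n : Cardinal.{u}) + 1)) ∧
    (Ceca.IsPointLT A ℵ₀ → (∀ α β, α ≠ β → #(A α ∩ A β : Set X) ≤ σ) →
      ∃ A' : ι → Set X, (∀ α, A' α ⊆ A α ∧ #(A' α) ≤ σ) ∧
        Ceca.IsPointLT (fun α => A α \ A' α) ((n : Cardinal.{u}) + 1)) := by
  have hσω : ℵ₀ ≤ σ := hσ.aleph0_le
  refine ⟨fun hceca hcond => ?_, fun hfin hle => ?_⟩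
  · obtain ⟨hle, hS⟩ : (∀ α β, α ≠ β → #(A α ∩ A β : Set X) ≤ σ) ∧
        ∀ S : Set X, #S = σ → #{α | S ⊆ A α} ≤ σ := by
      rcases hcond with hlt | ⟨hle, hS⟩
      · -- A set of size `σ` is included in at most one member.
        refine ⟨fun α β h => (hlt α β h).le, fun S hSc => ?_⟩
        refine le_trans (mk_le_one_iff_set_subsingleton.2 fun α hα β hβ => ?_)
          (one_le_aleph0.trans hσω)
        by_contra hne
        exact (hlt α β hne).not_ge (hSc ▸ mk_le_mk_of_subset (Set.subset_inter hα hβ))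
      · refine ⟨hle, fun S hSc => ?_⟩
        by_cases hsub : S ⊆ ⋃ α, A α
        · exact hS S hsub hSc
        · have : {α | S ⊆ A α} = ∅ := Set.eq_empty_of_forall_notMem fun α hα =>
            hsub (Set.Subset.trans hα (Set.subset_iUnion A α))
          simp [this]
    obtain ⟨A', h1, h2⟩ := (isEssentiallyPointLE_of_hasRanking hσω hle
      (fun μ hσμ K hK => hasRanking_of_ceca hceca hσω hσμ hle hS hK) hn hA
      Set.univ).exists_isPointLT
    exact ⟨A', fun α => (h1 α).2, h2⟩
  · exact (isEssentiallyPointLE_of_hasRanking hσω hle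
      (fun μ hσμ K hK => hasRanking_of_pointFinite hσω hσμ (finite_of_isPointLT_aleph0 hfin) hle hK)
      hn hA Set.univ).exists_isPointLT
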